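/- **Setting.** Let $\mathcal L$ be a countable first-order language (function, constant and relation symbols allowed). $\mathsf{Mod}(\mathcal L)$ is the Polish space of $\mathcal L$-structures with domain $\mathbb N$, with the product topology of $\prod_{f}\mathbb N^{\mathbb N^{\mathrm{ar}(f)}}\times\prod_{R}2^{\mathbb N^{\mathrm{ar}(R)}}$. An equivalence relation $E$ on $X$ is *Borel graphable with diameter $2$* if there is a Borel (undirected, simple) graph $G$ on $X$ such that $x\mathrel E y$ iff $x$ and $y$ are connected in $G$, and any two connected vertices have distance at most $2$ in $G$. A structure $M\in\mathsf{Mod}(\mathcal L)$ is *trivial* if there is a finite $F\subset\mathbb N$ such that any two tuples of the same length, each consisting of distinct elements of $\mathbb N\setminus F$, satisfy in $M$ the same quantifier-free formulas with parameters from $F$. An *unfolding* of $E$ is a Borel set $C\subseteq X^2\times 2^{\mathbb N}$ with $(x,x,z)\in C$ for all $x,z$; $(x,y,z)\in C\iff(y,x,z)\in C$; and $x\mathrel E y\iff\exists z\,(x,y,z)\in C$. $E$ has the *Borel witness coding property* (via $f$, with respect to $C$) if $f\colon X\to 2^{\mathbb N}$ is Borel and for all $x\in X$, $a\in 2^{\mathbb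 N}$ there is $y\mathrel E x$ such that $f(y)$ computes both $a$ and some $z$ with $(x,y,z)\in C$. Given an injective numbering $\nu$ of the symbols of $\mathcal L$ by natural numbers, $\mathcal L$ is identified with the real listing the number, kind and arity of each symbol, and $M\in\mathsf{Mod}(\mathcal L)$ with the real listing the graphs of its functions and its relations. **Theorem.** Let $\mathcal L$ be a countable language. 1. The isomorphism relation on $\mathsf{Mod}(\mathcal L)$ is Borel graphable with diameter $2$. 2. The set of trivial structures in $\mathsf{Mod}(\mathcal L)$ is Borel and invariant under isomorphism. 3. If $M,N\in\mathsf{Mod}(\mathcal L)$ are trivial and isomorphic, then there is a computable isomorphism from $M$ to $N$; and the isomorphism relation restricted to the trivial structures is Borel. 4. The isomorphism relation restricted to the non-trivial structures has the Borel witness coding property. For every injective numbering $\nu$ of the symbols, it has this property via the map $M\mapsto(M\oplus\mathcal L)'$ (the Turing jump of $M\oplus\mathcal L$), with respect to the unfolding consisting of the $(M,N,z)$ such that $M=N$, or $z$ is the graph of an isomorphism from $M$ to $N$ or from $N$ to $M$. In fact, for every non-trivial $M\in\mathsf{Mod}(\mathcal L)$ and every $r\in 2^{\mathbb N}$ there is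 $N\in\mathsf{Mod}(\mathcal L)$ isomorphic to $M$ such that $(N\oplus\mathcal L)'$ computes both $r$ and an isomorphism from $M$ to $N$. -/

import Mathlib

universe u v

namespace BorelGraphing

noncomputable section

/-! ### Reals, Turing computability and the Turing jump -/

/-- Cantor space `2^ℕ`; its elements are also regarded as subsets of `ℕ`. -/
abbrev Cantor : Type := ℕ → Bool

/-- The characteristic function of a real, as a (total) partial function on `ℕ`. -/
def charFun (a : Cantor) : ℕ →. ℕ := fun n => Part.some (a n).toNat

/-- The real `w` computes the real `z`, that is, `z` is Turing reducible to `w`. -/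
def Computes (w z : Cantor) : Prop := TuringReducible (charFun z) (charFun w)

/-- Programs for partial functions `ℕ →. ℕ` recursive in an oracle. -/
inductive OracleCode : Type
  | zero : OracleCode
  | succ : OracleCode
  | left : OracleCode
  | right : OracleCode
  | oracle : OracleCode
  | pair : OracleCode → OracleCode → OracleCode
  | comp : OracleCode → OracleCode → OracleCode
  | prec : OracleCode → OracleCode → OracleCode
  | rfind : OracleCode → OracleCode

namespace OracleCode

/-- The partial function computed by a program with oracle `g`. -/
def eval (g : ℕ →. ℕ) : OracleCode → ℕ →. ℕ
  | zero => fun _ => Part.some 0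
  | succ => fun n => Part.some (n + 1)
  | left => fun n => Part.some (Nat.unpair n).1
  | right => fun n => Part.some (Nat.unpair n).2
  | oracle => g
  | pair c d => fun n => Nat.pair <$> eval g c n <*> eval g d n
  | comp c d => fun n => eval g d n >>= eval g c
  | prec c d => fun p =>
      let (a, n) := Nat.unpair p
      n.rec (eval g c a) fun y IH => do
        let i ← IH
        eval g d (Nat.pair a (Nat.pair y i))
  | rfind c => fun a => Nat.rfind fun n => (fun m => m = 0) <$> eval g c (Nat.pair a n)

/-- The Gödel number of a program. -/
def index : OracleCode → ℕ
  | zero => Nat.pair 0 0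
  | succ => Nat.pair 1 0
  | left => Nat.pair 2 0
  | right => Nat.pair 3 0
  | oracle => Nat.pair 4 0
  | pair c d => Nat.pair 5 (Nat.pair (index c) (index d))
  | comp c d => Nat.pair 6 (Nat.pair (index c) (index d))
  | prec c d => Nat.pair 7 (Nat.pair (index c) (index d))
  | rfind c => Nat.pair 8 (index c)

theorem index_injective : Function.Injective index := by
  intro c
  induction c with
  | pair c d hc hd | comp c d hc hd | prec c d hc hd =>
    intro e h
    cases e <;> simp only [index, Nat.pair_eq_pair] at h <;> try omega
    rw [hc h.2.1, hd h.2.2]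
  | rfind c hc =>
    intro e h
    cases e <;> simp only [index, Nat.pair_eq_pair] at h <;> try omega
    rw [hc h.2]
  | _ =>
    intro e h
    cases e <;> simp only [index, Nat.pair_eq_pair] at h <;> first | rfl | omega

/-- The programs compute exactly the partial functions recursive in the oracle. -/
theorem exists_eval_iff (g f : ℕ →. ℕ) :
    (∃ c : OracleCode, c.eval g = f) ↔ Nat.RecursiveIn {g} f := by
  constructor
  · rintro ⟨c, rfl⟩
    induction c with
    | zero => exact .zero
    | succ => exact .succ
    | left => exact .left
    | right => exact .right
    | oracle => exact .oracle g rfl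
    | pair c d hc hd => exact .pair hc hd
    | comp c d hc hd => exact .comp hc hd
    | prec c d hc hd => exact .prec hc hd
    | rfind c hc => exact .rfind hc
  · intro h
    induction h with
    | zero => exact ⟨zero, rfl⟩
    | succ => exact ⟨succ, rfl⟩
    | left => exact ⟨left, rfl⟩
    | right => exact ⟨right, rfl⟩
    | oracle k hk => exact ⟨oracle, hk.symm⟩
    | pair _ _ hc hd =>
      obtain ⟨c, rfl⟩ := hc
      obtain ⟨d, rfl⟩ := hd
      exact ⟨pair c d, rfl⟩
    | comp _ _ hc hd =>
      obtain ⟨c, rfl⟩ := hc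
      obtain ⟨d, rfl⟩ := hd
      exact ⟨comp c d, rfl⟩
    | prec _ _ hc hd =>
      obtain ⟨c, rfl⟩ := hc
      obtain ⟨d, rfl⟩ := hd
      exact ⟨prec c d, rfl⟩
    | rfind _ hc =>
      obtain ⟨c, rfl⟩ := hc
      exact ⟨rfind c, rfl⟩

end OracleCode

open Classical in
/-- The Turing jump of `a`: the set of all Gödel numbers `n` of programs which, with oracle `a`,
halt on input `n`. -/
def jump (a : Cantor) : Cantor := fun n =>
  decide (∃ c : OracleCode, c.index = n ∧ (c.eval (charFun a) n).Dom)

/-- The join `a ⊕ b`: `a` on the even numbers and `b` on the odd numbers. -/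
def join (a b : Cantor) : Cantor := fun n => if n % 2 = 0 then a (n / 2) else b (n / 2)

/-! ### Borel graphability and the Borel witness coding property -/

section General

variable {X : Type*} [MeasurableSpace X]

/-- `G` is a Borel graphing of `E`: a Borel graph whose connectedness relation is `E`. -/
def IsBorelGraphing (E : Setoid X) (G : SimpleGraph X) : Prop :=
  MeasurableSet {p : X × X | G.Adj p.1 p.2} ∧ ∀ x y, E x y ↔ G.Reachable x y

/-- `E` is Borel graphable with diameter (at most) `d`: it has a Borel graphing in which any two
connected vertices are at distance at most `d`. -/
def IsBorelGraphableWithDiam (E : Setoid X) (d : ℕ) : Prop :=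
  ∃ G : SimpleGraph X, IsBorelGraphing E G ∧ ∀ x y, G.Reachable x y → G.dist x y ≤ d

/-- `C` is an unfolding of `E`; `z` with `(x, y, z) ∈ C` is a witness to `E x y`. -/
structure IsUnfolding (E : Setoid X) (C : Set (X × X × Cantor)) : Prop where
  measurableSet : MeasurableSet C
  refl_mem : ∀ x z, (x, x, z) ∈ C
  symm_mem : ∀ x y z, (x, y, z) ∈ C ↔ (y, x, z) ∈ C
  rel_iff : ∀ x y, E x y ↔ ∃ z, (x, y, z) ∈ C

/-- The Borel function `f` verifies the Borel witness coding property of `E` with respect to the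
unfolding `C`. -/
structure IsWitnessCoding (E : Setoid X) (C : Set (X × X × Cantor)) (f : X → Cantor) : Prop where
  isUnfolding : IsUnfolding E C
  measurable : Measurable f
  coding : ∀ x a, ∃ y, E x y ∧ Computes (f y) a ∧ ∃ z, (x, y, z) ∈ C ∧ Computes (f y) z

/-- The Borel witness coding property. -/
def HasBorelWitnessCodingProperty (E : Setoid X) : Prop :=
  ∃ C f, IsWitnessCoding E C f

end General

/-! ### The space of countable structures -/

/-- `Mod(L)`: the set of `L`-structures with domain `ℕ`. -/
def ModSpace (L : FirstOrder.Language.{u, v}) : Type (max u v) := L.Structure ℕ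

variable {L : FirstOrder.Language.{u, v}}

/-- The interpretation of a function symbol. -/
def ModSpace.fn (M : ModSpace L) {n : ℕ} (f : L.Functions n) (x : Fin n → ℕ) : ℕ :=
  @FirstOrder.Language.Structure.funMap L ℕ M n f x

/-- The interpretation of a relation symbol. -/
def ModSpace.rel (M : ModSpace L) {n : ℕ} (R : L.Relations n) (x : Fin n → ℕ) : Prop :=
  @FirstOrder.Language.Structure.RelMap L ℕ M n R x

open Classical in
/-- `Mod(L)` as the product of the spaces `ℕ^(ℕ^n)` over the `n`-ary function symbols and `2^(ℕ^n)`
over the `n`-ary relation symbols. -/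
def ModSpace.equivProd (L : FirstOrder.Language.{u, v}) : ModSpace L ≃
    ((s : Σ n, L.Functions n) → (Fin s.1 → ℕ) → ℕ) ×
      ((s : Σ n, L.Relations n) → (Fin s.1 → ℕ) → Bool) where
  toFun M := (fun s x => M.fn s.2 x, fun s x => decide (M.rel s.2 x))
  invFun p :=
    { funMap := fun {n} f x => p.1 ⟨n, f⟩ x
      RelMap := fun {n} R x => p.2 ⟨n, R⟩ x = true }
  left_inv M := by
    obtain ⟨f, R⟩ := M
    have h : (fun (n : ℕ) (S : L.Relations n) (x : Fin n → ℕ) => decide (R S x) = true) =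
        fun _ => R := by
      funext n S x
      exact decide_eq_true_eq
    exact congrArg (fun R' : (n : ℕ) → L.Relations n → (Fin n → ℕ) → Prop =>
      FirstOrder.Language.Structure.mk f (fun {n} => R' n)) h
  right_inv p := by
    refine Prod.ext rfl ?_
    funext s x
    exact Bool.eq_iff_iff.2 decide_eq_true_iff

/-- The product topology on `Mod(L)` (with `ℕ` and `2` discrete). -/
instance : TopologicalSpace (ModSpace L) :=
  TopologicalSpace.induced (ModSpace.equivProd L) inferInstance

instance : MeasurableSpace (ModSpace L) := borel _

instance : BorelSpace (ModSpace L) := ⟨rfl⟩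

instance [Countable L.Symbols] : PolishSpace (ModSpace L) := by
  have : Countable (Σ n, L.Functions n) :=
    (Sum.inl_injective (β := Σ n, L.Relations n)).countable
  have : Countable (Σ n, L.Relations n) :=
    (Sum.inr_injective (α := Σ n, L.Functions n)).countable
  have : TopologicalSpace.SeparableSpace
      ((s : Σ n, L.Relations n) → (Fin s.1 → ℕ) → Bool) := inferInstance
  have : PolishSpace ((s : Σ n, L.Relations n) → (Fin s.1 → ℕ) → Bool) := inferInstance
  exact ((ModSpace.equivProd L).toHomeomorphOfIsInducing ⟨rfl⟩).isClosedEmbedding.polishSpace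

/-- The type of isomorphisms from `M` to `N`. -/
abbrev Isom (M N : ModSpace L) : Type := @FirstOrder.Language.Equiv L ℕ ℕ M N

/-- The underlying bijection of an isomorphism. -/
def Isom.toPerm {M N : ModSpace L} (e : Isom M N) : ℕ ≃ ℕ :=
  @FirstOrder.Language.Equiv.toEquiv L ℕ ℕ M N e

/-- The isomorphism relation on `Mod(L)`. -/
def isoSetoid (L : FirstOrder.Language.{u, v}) : Setoid (ModSpace L) where
  r M N := Nonempty (Isom M N)
  iseqv :=
    { refl := fun M => ⟨@FirstOrder.Language.Equiv.refl L ℕ M⟩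
      symm := fun {M N} ⟨e⟩ => ⟨@FirstOrder.Language.Equiv.symm L ℕ ℕ M N e⟩
      trans := fun {M N P} ⟨e⟩ ⟨d⟩ => ⟨@FirstOrder.Language.Equiv.comp L ℕ ℕ M N ℕ P d e⟩ }

/-- The isomorphism relation restricted to the structures in `S`. -/
def isoSetoidOn (S : Set (ModSpace L)) : Setoid S := (isoSetoid L).comap Subtype.val

/-- The quantifier-free type of the tuple `a` over `F` in `M`. A formula in the variables
`x_0, …, x_(n-1)` with parameters from `F` is a formula whose free variables are indexed by
`F ⊕ Fin n`, where a variable in `F` is evaluated to itself. -/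
def qfType (M : ModSpace L) (F : Finset ℕ) {n : ℕ} (a : Fin n → ℕ) :
    Set (L.Formula (F ⊕ Fin n)) :=
  {φ | φ.IsQF ∧ @FirstOrder.Language.Formula.Realize L ℕ M _ φ (Sum.elim (fun i : F => (i : ℕ)) a)}

/-- `M` is trivial: for some finite `F`, any two tuples (of the same length) of distinct elements
outside `F` have the same quantifier-free type over `F`. -/
def IsTrivial (M : ModSpace L) : Prop :=
  ∃ F : Finset ℕ, ∀ (n : ℕ) (a b : Fin n → ℕ), Function.Injective a → Function.Injective b →
    (∀ i, a i ∉ F) → (∀ i, b i ∉ F) → qfType M F a = qfType M F b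

/-- The set of trivial `L`-structures with domain `ℕ`. -/
def trivialStructures (L : FirstOrder.Language.{u, v}) : Set (ModSpace L) := {M | IsTrivial M}

/-- The set of non-trivial `L`-structures with domain `ℕ`. -/
def nontrivialStructures (L : FirstOrder.Language.{u, v}) : Set (ModSpace L) := {M | ¬ IsTrivial M}

/-! ### Reals coding languages, structures and isomorphisms -/

open Classical in
/-- The real representing the language `L`, given an enumeration `ν` of its symbols: it lists, with
the number of each symbol, its kind (function or relation) and its arity. -/
def languageCode (ν : L.Symbols → ℕ) : Cantor := fun k => decide
  ((∃ (n : ℕ) (f : L.Functions n), k = Nat.pair (ν (Sum.inl ⟨n, f⟩)) (Nat.pair 0 n)) ∨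
   (∃ (n : ℕ) (R : L.Relations n), k = Nat.pair (ν (Sum.inr ⟨n, R⟩)) (Nat.pair 1 n)))

open Classical in
/-- The real representing the structure `M`, given an enumeration `ν` of the symbols of `L`: the
graphs of the functions and the relations of `M`. -/
def structureCode (ν : L.Symbols → ℕ) (M : ModSpace L) : Cantor := fun k => decide
  ((∃ (n : ℕ) (f : L.Functions n) (x : Fin n → ℕ),
      k = Nat.pair (ν (Sum.inl ⟨n, f⟩)) (Encodable.encode (M.fn f x :: List.ofFn x))) ∨
   (∃ (n : ℕ) (R : L.Relations n) (x : Fin n → ℕ), M.rel R x ∧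
      k = Nat.pair (ν (Sum.inr ⟨n, R⟩)) (Encodable.encode (List.ofFn x))))

/-- The real `z` is (the graph of) an isomorphism from `M` to `N`. -/
def CodesIsom (M N : ModSpace L) (z : Cantor) : Prop :=
  ∃ e : Isom M N, ∀ m n, z (Nat.pair m n) = true ↔ Isom.toPerm e m = n

/-- The natural unfolding of isomorphism on `S`: `z` is a witness to `M ≅ N` if it is an
isomorphism from `M` to `N` or from `N` to `M` (and every `z` is a witness to `M ≅ M`). -/
def isoUnfolding (S : Set (ModSpace L)) : Set (S × S × Cantor) :=
  {p | p.1 = p.2.1 ∨ CodesIsom p.1.1 p.2.1.1 p.2.2 ∨ CodesIsom p.2.1.1 p.1.1 p.2.2}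

end

end BorelGraphing

/-!
Two elements of a structure `M` are indistinguishable if their transposition is an automorphism of
`M`. A structure is trivial if and only if all elements outside some finite set are
indistinguishable, equivalently if all permutations fixing some finite set pointwise are
automorphisms (`isTrivial_iff_exists_swap`, `isTrivial_iff_exists_perm`). Hence an isomorphism of
trivial structures may be changed outside a finite set, and so may be taken to be finitely
supported. As there are countably many finitely supported permutations, all computable, this settles
the claims on trivial structures.

A non-trivial structure `M`, on the other hand, has distinguishable elements outside any finite set.
A copy `N` of `M` is built by finite extension (`exists_coding`). The step for one bit starts at a
position `k` that a decoder knows. Distinguishable elements are put at the positions `k` and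
`k + 1`, and elements are added until some atomic fact changes its truth value in `N` when `k` and
`k + 1` are exchanged. The least such fact can be found from `N`, and it is the same after the
exchange, but with the other truth value; so this truth value is the coded bit, and the position of
the next step is determined by the code of the fact. A bit may depend on everything decided before,
so the bits can be chosen to be those of a given real and of the isomorphism from `M` to `N`
itself (`exists_codesIsom_computes`). So `N` computes both, and its jump does a fortiori.

For the graphing, let `M` and `N` be isomorphic and non-trivial. Some copy `P` of `M` computes an
isomorphism from `M` to `P` and one from `M` to `N`, hence also one from `N` to `P`. So it
suffices to join structures if one of them computes an isomorphism between them. This is a Borel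
condition, because there are countably many programs.
-/

namespace BorelGraphing

open FirstOrder FirstOrder.Language Equiv

/-! ### Isomorphisms as permutations of `ℕ` -/

section Isomorphisms

variable {L : FirstOrder.Language.{u, v}} {M N P : ModSpace L}

/-- The permutation `g` of `ℕ` is an isomorphism from `M` to `N`. -/
def IsIsoPerm (M N : ModSpace L) (g : Perm ℕ) : Prop :=
  (∀ (n : ℕ) (f : L.Functions n) (x : Fin n → ℕ), g (M.fn f x) = N.fn f (g ∘ x)) ∧
    ∀ (n : ℕ) (R : L.Relations n) (x : Fin n → ℕ), N.rel R (g ∘ x) ↔ M.rel R x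

theorem Isom.isIsoPerm (e : Isom M N) : IsIsoPerm M N (Isom.toPerm e) :=
  ⟨fun _ f x => @FirstOrder.Language.Equiv.map_fun' L ℕ ℕ M N e _ f x,
    fun _ R x => @FirstOrder.Language.Equiv.map_rel' L ℕ ℕ M N e _ R x⟩

theorem IsIsoPerm.exists_isom {g : Perm ℕ} (h : IsIsoPerm M N g) :
    ∃ e : Isom M N, Isom.toPerm e = g :=
  ⟨@FirstOrder.Language.Equiv.mk L ℕ ℕ M N g (fun {n} f x => h.1 n f x)
    (fun {n} R x => h.2 n R x), rfl⟩

theorem IsIsoPerm.refl (M : ModSpace L) : IsIsoPerm M M (Equiv.refl ℕ) :=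
  ⟨fun _ _ _ => rfl, fun _ _ _ => Iff.rfl⟩

theorem IsIsoPerm.symm {g : Perm ℕ} (h : IsIsoPerm M N g) : IsIsoPerm N M g.symm := by
  have key : ∀ {n : ℕ} (x : Fin n → ℕ), g ∘ (g.symm ∘ x) = x := fun x => by
    funext i; simp
  refine ⟨fun n f x => ?_, fun n R x => ?_⟩
  · rw [Equiv.symm_apply_eq, h.1, key]
  · rw [← h.2, key]

theorem IsIsoPerm.trans {g k : Perm ℕ} (h : IsIsoPerm M N g) (h' : IsIsoPerm N P k) :
    IsIsoPerm M P (g.trans k) := by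
  refine ⟨fun n f x => ?_, fun n R x => ?_⟩
  · rw [Equiv.trans_apply, h.1, h'.1]; rfl
  · rw [← h.2, ← h'.2]; rfl

theorem nonempty_isom_iff : Nonempty (Isom M N) ↔ ∃ g, IsIsoPerm M N g :=
  ⟨fun ⟨e⟩ => ⟨_, e.isIsoPerm⟩, fun ⟨_, h⟩ => ⟨h.exists_isom.choose⟩⟩

theorem isIsoPerm_refl_iff : IsIsoPerm M N (Equiv.refl ℕ) ↔ M = N := by
  refine ⟨fun h => (ModSpace.equivProd L).injective (Prod.ext ?_ ?_), fun h => h ▸ .refl M⟩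
  · funext s x
    exact h.1 s.1 s.2 x
  · funext s x
    exact decide_eq_decide.2 (h.2 s.1 s.2 x).symm

/-- The structure on `ℕ` that makes `g` an isomorphism onto `M`. -/
def ModSpace.pullback (M : ModSpace L) (g : Perm ℕ) : ModSpace L where
  funMap f x := g.symm (M.fn f (g ∘ x))
  RelMap R x := M.rel R (g ∘ x)

theorem ModSpace.isIsoPerm_pullback (M : ModSpace L) (g : Perm ℕ) :
    IsIsoPerm (M.pullback g) M g :=
  ⟨fun _ _ _ => g.apply_symm_apply _, fun _ _ _ => Iff.rfl⟩

/-! ### Trivial structures -/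

/-- If `F` witnesses triviality of `M`, then all permutations fixing `F` pointwise are
automorphisms: the graph of a function and a relation are defined by quantifier-free formulas, in
which the elements of `F` occur as parameters and the other elements as distinct variables. -/
theorem isIsoPerm_of_qfType_eq {F : Finset ℕ}
    (hF : ∀ (n : ℕ) (a b : Fin n → ℕ), Function.Injective a → Function.Injective b →
      (∀ i, a i ∉ F) → (∀ i, b i ∉ F) → qfType M F a = qfType M F b)
    {g : Perm ℕ} (hg : ∀ i ∈ F, g i = i) : IsIsoPerm M M g := by
  have hg' : ∀ i, i ∉ F → g i ∉ F := fun i hi h => hi (by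
    have := hg _ h
    rwa [g.injective this] at h)
  have hcomp : ∀ {n : ℕ} (a : Fin n → ℕ) (w : F ⊕ Fin n),
      Sum.elim (fun i : F => (i : ℕ)) (g ∘ a) w = g (Sum.elim (fun i : F => (i : ℕ)) a w) := by
    rintro n a (w | w)
    · exact (hg w w.2).symm
    · rfl
  -- the elements of a finite set are named by parameters and distinct variables
  have hname : ∀ S : Finset ℕ, ∃ (n : ℕ) (a : Fin n → ℕ),
      Function.Injective a ∧ (∀ i, a i ∉ F) ∧
      ∀ u ∈ S, ∃ w, Sum.elim (fun i : F => (i : ℕ)) a w = u := by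
    intro S
    refine ⟨(S \ F).card, fun i => (S \ F).equivFin.symm i,
      Subtype.val_injective.comp (Equiv.injective _),
      fun i => (Finset.mem_sdiff.1 ((S \ F).equivFin.symm i).2).2, fun u hu => ?_⟩
    by_cases h : u ∈ F
    · exact ⟨.inl ⟨u, h⟩, rfl⟩
    · exact ⟨.inr ((S \ F).equivFin ⟨u, Finset.mem_sdiff.2 ⟨hu, h⟩⟩), by simp⟩
  let _ : L.Structure ℕ := M
  have htrans : ∀ {n : ℕ} (a : Fin n → ℕ), Function.Injective a → (∀ i, a i ∉ F) →
      ∀ φ : L.Formula (F ⊕ Fin n), φ.IsQF →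
      (φ.Realize (Sum.elim (fun i : F => (i : ℕ)) a) ↔
        φ.Realize (g ∘ Sum.elim (fun i : F => (i : ℕ)) a)) := by
    intro n a ha ha' φ hφ
    have h := Set.ext_iff.1 (hF n a (g ∘ a) ha (g.injective.comp ha) ha'
      fun i => hg' _ (ha' i)) φ
    rw [← show _ = g ∘ _ from funext (hcomp a)]
    exact ⟨fun h' => (h.1 ⟨hφ, h'⟩).2, fun h' => (h.2 ⟨hφ, h'⟩).2⟩
  refine ⟨fun n f x => ?_, fun n R x => ?_⟩
  · obtain ⟨k, a, ha, ha', hw⟩ := hname (insert (M.fn f x) (Finset.univ.image x))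
    obtain ⟨w₀, hw₀⟩ := hw (M.fn f x) (Finset.mem_insert_self _ _)
    have : ∀ i, ∃ w, Sum.elim (fun i : F => (i : ℕ)) a w = x i := fun i =>
      hw _ (Finset.mem_insert_of_mem (Finset.mem_image_of_mem x (Finset.mem_univ i)))
    choose w hw using this
    have h := htrans a ha ha'
      (Term.equal (Term.func f fun i => Term.var (w i)) (Term.var w₀))
      (BoundedFormula.IsAtomic.equal _ _).isQF
    simp only [Formula.realize_equal, Term.realize_func, Term.realize_var, Function.comp_apply,
      hw, hw₀] at h
    exact (h.1 rfl).symm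
  · obtain ⟨k, a, ha, ha', hw⟩ := hname (Finset.univ.image x)
    have : ∀ i, ∃ w, Sum.elim (fun i : F => (i : ℕ)) a w = x i := fun i =>
      hw _ (Finset.mem_image_of_mem x (Finset.mem_univ i))
    choose w hw using this
    have h := htrans a ha ha' (Relations.formula R fun i => Term.var (w i))
      (BoundedFormula.IsAtomic.rel _ _).isQF
    simp only [Formula.realize_rel, Term.realize_var, Function.comp_apply, hw] at h
    exact h.symm

/-- If all transpositions of elements outside `F` are automorphisms, then `F` witnesses triviality:
a product of such transpositions takes a given tuple to another given one. -/
theorem qfType_eq_of_isIsoPerm_swap {F : Finset ℕ}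
    (hF : ∀ x y, x ∉ F → y ∉ F → IsIsoPerm M M (Equiv.swap x y)) {n : ℕ} {a b : Fin n → ℕ}
    (ha : Function.Injective a) (hb : Function.Injective b) (ha' : ∀ i, a i ∉ F)
    (hb' : ∀ i, b i ∉ F) : qfType M F a = qfType M F b := by
  have main : ∀ m ≤ n, ∃ g, IsIsoPerm M M g ∧ (∀ i ∈ F, g i = i) ∧
      ∀ i : Fin n, i < m → g (a i) = b i := by
    intro m
    induction m with
    | zero => exact fun _ => ⟨_, .refl M, fun _ _ => rfl, fun i hi => absurd hi (Nat.not_lt_zero _)⟩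
    | succ m ih =>
      intro hm
      obtain ⟨g, hg, hgF, hgab⟩ := ih (by omega)
      have hga : g (a ⟨m, hm⟩) ∉ F := fun h => ha' ⟨m, hm⟩ (by
        have := hgF _ h
        rwa [g.injective this] at h)
      refine ⟨g.trans (swap (g (a ⟨m, hm⟩)) (b ⟨m, hm⟩)), hg.trans (hF _ _ hga (hb' _)),
        fun i hi => ?_, fun i hi => ?_⟩
      · rw [Equiv.trans_apply, hgF i hi]
        exact swap_apply_of_ne_of_ne (fun h => hga (h ▸ hi)) (fun h => hb' _ (h ▸ hi))
      · rw [Equiv.trans_apply]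
        rcases eq_or_ne i ⟨m, hm⟩ with rfl | hne
        · exact swap_apply_left _ _
        · have hlt : (i : ℕ) < m := lt_of_le_of_ne (Nat.lt_succ_iff.1 hi) fun h => hne (Fin.ext h)
          rw [swap_apply_of_ne_of_ne (fun h => hne (ha (g.injective h))), hgab i hlt]
          exact fun h => hne (hb (hgab i hlt ▸ h))
  obtain ⟨g, hg, hgF, hgab⟩ := main n le_rfl
  obtain ⟨e, rfl⟩ := hg.exists_isom
  let _ : L.Structure ℕ := M
  ext φ
  have hv : Sum.elim (fun i : F => (i : ℕ)) b =
      Isom.toPerm e ∘ Sum.elim (fun i : F => (i : ℕ)) a := by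
    funext i
    rcases i with i | i
    · exact (hgF i i.2).symm
    · exact (hgab i i.2).symm
  change _ ∧ _ ↔ _ ∧ φ.Realize (Sum.elim (fun i : F => (i : ℕ)) b)
  rw [hv]
  exact and_congr_right fun _ =>
    (StrongHomClass.realize_formula (show FirstOrder.Language.Equiv L ℕ ℕ from e) φ).symm

theorem isTrivial_iff_exists_perm :
    IsTrivial M ↔ ∃ F : Finset ℕ, ∀ g : Perm ℕ, (∀ i ∈ F, g i = i) → IsIsoPerm M M g :=
  ⟨fun ⟨F, hF⟩ => ⟨F, fun _ => isIsoPerm_of_qfType_eq hF⟩,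
    fun ⟨F, hF⟩ => ⟨F, fun _ _ _ => qfType_eq_of_isIsoPerm_swap fun _ _ hx hy => hF _ fun _ hi =>
      swap_apply_of_ne_of_ne (fun h => hx (h ▸ hi)) (fun h => hy (h ▸ hi))⟩⟩

theorem isTrivial_iff_exists_swap :
    IsTrivial M ↔ ∃ F : Finset ℕ, ∀ x y, x ∉ F → y ∉ F → IsIsoPerm M M (swap x y) :=
  ⟨fun ⟨F, hF⟩ => ⟨F, fun _ _ hx hy => isIsoPerm_of_qfType_eq hF fun _ hi =>
      swap_apply_of_ne_of_ne (fun h => hx (h ▸ hi)) (fun h => hy (h ▸ hi))⟩,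
    fun ⟨F, hF⟩ => ⟨F, fun _ _ _ => qfType_eq_of_isIsoPerm_swap hF⟩⟩

theorem IsTrivial.of_isIsoPerm {g : Perm ℕ} (hg : IsIsoPerm M N g) (hM : IsTrivial M) :
    IsTrivial N := by
  rw [isTrivial_iff_exists_perm] at hM ⊢
  obtain ⟨F, hF⟩ := hM
  refine ⟨F.map g.toEmbedding, fun k hk => ?_⟩
  have h := (hg.symm.trans (hF ((g.trans k).trans g.symm) fun i hi => ?_)).trans hg
  · convert h using 1
    ext i
    simp
  · simp [hk (g i) (Finset.mem_map_of_mem _ hi)]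

/-! ### Isomorphisms of trivial structures -/

/-- The function that agrees with the finite table `l`, and is the identity beyond it. -/
def tableFun (l : List ℕ) (n : ℕ) : ℕ := (l[n]?).getD n

theorem computable_tableFun (l : List ℕ) : Computable (tableFun l) :=
  (Primrec.option_getD.comp (Primrec.list_getElem?.comp (Primrec.const l) Primrec.id)
    Primrec.id).to_comp

/-- An isomorphism of trivial structures can be replaced by any permutation that agrees with it on
a finite set witnessing triviality, in particular by a finitely supported one. -/
theorem IsTrivial.exists_tableFun (hM : IsTrivial M) {g : Perm ℕ} (hg : IsIsoPerm M N g) :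
    ∃ (l : List ℕ) (k : Perm ℕ), IsIsoPerm M N k ∧ ∀ n, k n = tableFun l n := by
  obtain ⟨F, hF⟩ := isTrivial_iff_exists_perm.1 hM
  obtain ⟨m, hm⟩ : ∃ m, ∀ i ∈ F, i < m ∧ g i < m := by
    refine ⟨F.sup (fun i => max i (g i)) + 1, fun i hi => ?_⟩
    have : max i (g i) ≤ _ := Finset.le_sup (f := fun i => max i (g i)) hi
    omega
  -- a permutation of `Fin m` that agrees with `g` on `F`
  let e : {i : Fin m // (i : ℕ) ∈ F} ≃ {j : Fin m // g.symm j ∈ F} :=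
    { toFun := fun i => ⟨⟨g i, (hm _ i.2).2⟩, by simpa using i.2⟩
      invFun := fun j => ⟨⟨g.symm j, (hm _ j.2).1⟩, j.2⟩
      left_inv := fun i => by simp
      right_inv := fun j => by simp }
  let p : Perm (Fin m) := e.extendSubtype
  have hp : ∀ i (hi : i ∈ F), (p ⟨i, (hm i hi).1⟩ : ℕ) = g i := fun i hi => by
    have := e.extendSubtype_apply_of_mem ⟨i, (hm i hi).1⟩ hi
    exact congrArg (fun j : Fin m => (j : ℕ)) this
  let k : Perm ℕ := p.extendDomain (Fin.equivSubtype)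
  have hk : ∀ i (hi : i < m), k i = p ⟨i, hi⟩ := fun i hi => by
    exact p.extendDomain_apply_subtype Fin.equivSubtype hi
  have hk' : ∀ i, ¬ i < m → k i = i := fun i hi =>
    p.extendDomain_apply_not_subtype Fin.equivSubtype hi
  refine ⟨List.ofFn fun i => (p i : ℕ), k, ?_, fun n => ?_⟩
  · have h := (hF (k.trans g.symm) fun i hi => ?_).trans hg
    · convert h using 1
      ext i
      simp
    · rw [Equiv.trans_apply, hk i (hm i hi).1, hp i hi, g.symm_apply_apply]
  · by_cases hn : n < m
    · simp [tableFun, hk n hn, hn]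
    · simp [tableFun, hk' n hn, hn]

end Isomorphisms

/-! ### The action of permutations on codes of atomic facts -/

section Codes

open Encodable Denumerable

/-- A code `⟨m, l⟩` stands for the atomic statement that the list `l` belongs to the relation, or to
the graph of the function, with number `m`. This is the action of `g` on the entries of `l`. -/
def actCode (g : ℕ → ℕ) (c : ℕ) : ℕ :=
  Nat.pair c.unpair.1 (encode ((ofNat (List ℕ) c.unpair.2).map g))

@[simp]
theorem actCode_pair (g : ℕ → ℕ) (m : ℕ) (l : List ℕ) :
    actCode g (Nat.pair m (encode l)) = Nat.pair m (encode (l.map g)) := by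
  simp [actCode]

theorem exists_eq_pair_encode (c : ℕ) : ∃ (m : ℕ) (l : List ℕ), c = Nat.pair m (encode l) :=
  ⟨c.unpair.1, ofNat (List ℕ) c.unpair.2, by simp⟩

theorem actCode_actCode (g h : ℕ → ℕ) (c : ℕ) : actCode g (actCode h c) = actCode (g ∘ h) c := by
  obtain ⟨m, l, rfl⟩ := exists_eq_pair_encode c
  simp

theorem actCode_id (c : ℕ) : actCode id c = c := by
  obtain ⟨m, l, rfl⟩ := exists_eq_pair_encode c
  simp

theorem lt_encode_of_mem {l : List ℕ} {i : ℕ} (h : i ∈ l) : i < encode l := by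
  induction l with
  | nil => simp at h
  | cons a l ih =>
    rw [Encodable.encode_list_cons, Nat.lt_succ_iff]
    rcases List.mem_cons.1 h with rfl | h
    · exact Nat.left_le_pair _ _
    · exact (ih h).le.trans (Nat.right_le_pair _ _)

theorem actCode_congr {g h : ℕ → ℕ} {c : ℕ} (H : ∀ i < c, g i = h i) :
    actCode g c = actCode h c := by
  obtain ⟨m, l, rfl⟩ := exists_eq_pair_encode c
  rw [actCode_pair, actCode_pair, List.map_congr_left fun i hi =>
    H i ((lt_encode_of_mem hi).trans_le (Nat.right_le_pair _ _))]

theorem actCode_swap_swap (i j c : ℕ) : actCode (swap i j) (actCode (swap i j) c) = c := by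
  rw [actCode_actCode, show swap i j ∘ swap i j = id from funext fun n => by simp, actCode_id]

variable {L : FirstOrder.Language.{u, v}} {M N : ModSpace L} {ν : L.Symbols → ℕ}

theorem structureCode_eq_true {c : ℕ} : structureCode ν M c = true ↔
    (∃ (n : ℕ) (f : L.Functions n) (x : Fin n → ℕ),
      c = Nat.pair (ν (Sum.inl ⟨n, f⟩)) (encode (M.fn f x :: List.ofFn x))) ∨
    ∃ (n : ℕ) (R : L.Relations n) (x : Fin n → ℕ), M.rel R x ∧
      c = Nat.pair (ν (Sum.inr ⟨n, R⟩)) (encode (List.ofFn x)) := by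
  classical exact decide_eq_true_iff

theorem structureCode_fn (hν : Function.Injective ν) {n : ℕ} (f : L.Functions n) (x : Fin n → ℕ)
    (w : ℕ) : structureCode ν M (Nat.pair (ν (Sum.inl ⟨n, f⟩)) (encode (w :: List.ofFn x))) = true ↔
      M.fn f x = w := by
  rw [structureCode_eq_true]
  constructor
  · rintro (⟨n', f', x', h⟩ | ⟨n', R', x', -, h⟩)
    · obtain ⟨h₁, h₂⟩ := Nat.pair_eq_pair.1 h
      cases Sum.inl_injective (hν h₁)
      obtain ⟨h₃, h₄⟩ := List.cons_eq_cons.1 (encode_injective h₂)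
      rw [List.ofFn_injective h₄, h₃]
    · exact absurd (hν (Nat.pair_eq_pair.1 h).1) (by simp)
  · rintro rfl
    exact .inl ⟨n, f, x, rfl⟩

theorem structureCode_rel (hν : Function.Injective ν) {n : ℕ} (R : L.Relations n) (x : Fin n → ℕ) :
    structureCode ν M (Nat.pair (ν (Sum.inr ⟨n, R⟩)) (encode (List.ofFn x))) = true ↔
      M.rel R x := by
  rw [structureCode_eq_true]
  constructor
  · rintro (⟨n', f', x', h⟩ | ⟨n', R', x', hx, h⟩)
    · exact absurd (hν (Nat.pair_eq_pair.1 h).1) (by simp)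
    · obtain ⟨h₁, h₂⟩ := Nat.pair_eq_pair.1 h
      cases Sum.inr_injective (hν h₁)
      rwa [List.ofFn_injective (encode_injective h₂)]
  · exact fun h => .inr ⟨n, R, x, h, rfl⟩

theorem structureCode_actCode {g : Perm ℕ} (hg : IsIsoPerm M N g) (c : ℕ) :
    structureCode ν N (actCode g c) = structureCode ν M c := by
  have key : ∀ {M N : ModSpace L} {g : Perm ℕ}, IsIsoPerm M N g → ∀ c,
      structureCode ν M c = true → structureCode ν N (actCode g c) = true := by
    intro M N g hg c
    rw [structureCode_eq_true, structureCode_eq_true]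
    rintro (⟨n, f, x, rfl⟩ | ⟨n, R, x, hx, rfl⟩)
    · exact .inl ⟨n, f, g ∘ x, by rw [actCode_pair, List.map_cons, List.map_ofFn, hg.1]⟩
    · exact .inr ⟨n, R, g ∘ x, (hg.2 n R x).2 hx, by rw [actCode_pair, List.map_ofFn]⟩
  refine Bool.eq_iff_iff.2 ⟨fun h => ?_, key hg c⟩
  have h' := key hg.symm _ h
  rwa [actCode_actCode, show g.symm ∘ g = id from funext g.symm_apply_apply, actCode_id] at h'

theorem isIsoPerm_of_structureCode_actCode (hν : Function.Injective ν) {g : Perm ℕ}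
    (h : ∀ c, structureCode ν N (actCode g c) = structureCode ν M c) : IsIsoPerm M N g := by
  refine ⟨fun n f x => ?_, fun n R x => ?_⟩
  · have h' := (structureCode_fn (M := M) hν f x (M.fn f x)).2 rfl
    rw [← h, actCode_pair, List.map_cons, List.map_ofFn, structureCode_fn hν] at h'
    exact h'.symm
  · rw [← structureCode_rel hν R x, ← h, actCode_pair, List.map_ofFn, structureCode_rel hν]

/-- In a non-trivial structure, outside any finite set there are two elements whose transposition
is not an automorphism. -/
theorem exists_actCode_swap_ne (hν : Function.Injective ν) (hM : ¬ IsTrivial M) (F : Finset ℕ) :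
    ∃ x y c, x ∉ F ∧ y ∉ F ∧ structureCode ν M (actCode (swap x y) c) ≠ structureCode ν M c := by
  by_contra! H
  exact hM (isTrivial_iff_exists_swap.2 ⟨F, fun x y hx hy =>
    isIsoPerm_of_structureCode_actCode hν fun c => H x y c hx hy⟩)

end Codes

/-! ### Coding by the order of two distinguishable elements -/

section Coding

/-- `t` is the least code at which `D` changes its value when `k` and `k + 1` are exchanged, and
which is not less than the code it is exchanged with. -/
def IsLeastSplit (D : Cantor) (k t : ℕ) : Prop :=
  IsLeast {c | actCode (swap k (k + 1)) c ≤ c ∧ D (actCode (swap k (k + 1)) c) ≠ D c} t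

theorem IsLeastSplit.lt {D : Cantor} {k t : ℕ} (h : IsLeastSplit D k t) : k < t := by
  by_contra! hk
  refine h.1.2 (congrArg D ?_)
  exact (actCode_congr fun i hi =>
    swap_apply_of_ne_of_ne (by omega) (by omega)).trans (actCode_id t)

theorem IsLeastSplit.congr {D D' : Cantor} {k t : ℕ} (h : IsLeastSplit D k t)
    (hD : ∀ c ≤ t, D c = D' c) : IsLeastSplit D' k t := by
  refine ⟨⟨h.1.1, ?_⟩, fun c hc => ?_⟩
  · rw [← hD _ h.1.1, ← hD _ le_rfl]
    exact h.1.2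
  · by_contra! hlt
    refine hlt.not_ge (h.2 ⟨hc.1, ?_⟩)
    rw [hD _ hlt.le, hD _ (hc.1.trans hlt.le)]
    exact hc.2

theorem IsLeastSplit.actCode_swap {D : Cantor} {k t : ℕ} (h : IsLeastSplit D k t) :
    IsLeastSplit (fun c => D (actCode (swap k (k + 1)) c)) k t := by
  unfold IsLeastSplit at h ⊢
  convert h using 3 with c
  dsimp only
  rw [actCode_swap_swap]
  exact and_congr_right fun _ => ne_comm

variable {D : Cantor}

/-- One coding step: all values of `h` below `k` are kept, `v` becomes a value, and the bit `b`
becomes the value of the pulled back `D` at the code that distinguishes `k` from `k + 1`. -/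
theorem exists_coding_step
    (hD : ∀ F : Finset ℕ, ∃ x y c, x ∉ F ∧ y ∉ F ∧ D (actCode (swap x y) c) ≠ D c)
    (h : Perm ℕ) (k v : ℕ) (b : Bool) :
    ∃ (h' : Perm ℕ) (t : ℕ), (∀ i < k, h' i = h i) ∧
      IsLeastSplit (fun c => D (actCode h' c)) k t ∧ D (actCode h' t) = b ∧
      ∃ j < t + 2, h' j = v := by
  -- place two distinguishable elements at the positions `k` and `k + 1`
  obtain ⟨h₁, t, hh₁, ht⟩ : ∃ (h₁ : Perm ℕ) (t : ℕ), (∀ i < k, h₁ i = h i) ∧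
      IsLeastSplit (fun c => D (actCode h₁ c)) k t := by
    obtain ⟨x, y, c, hx, hy, hc⟩ := hD ((Finset.range k).image h)
    obtain ⟨x, rfl⟩ := h.surjective x
    obtain ⟨y, rfl⟩ := h.surjective y
    have hx' : ¬ x < k := fun hlt => hx (Finset.mem_image_of_mem _ (Finset.mem_range.2 hlt))
    have hy' : ¬ y < k := fun hlt => hy (Finset.mem_image_of_mem _ (Finset.mem_range.2 hlt))
    have hxy : x ≠ y := by
      rintro rfl
      refine hc ?_
      rw [swap_self, Equiv.coe_refl, actCode_id]
    have hy'' : swap k x y ≠ k := fun h => hxy <| by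
      rw [swap_apply_eq_iff, swap_apply_left] at h
      exact h.symm
    have hylt : ¬ swap k x y < k := by
      rw [swap_apply_def]
      split_ifs <;> omega
    let h₁ : Perm ℕ := ((swap (k + 1) (swap k x y)).trans (swap k x)).trans h
    have hk : h₁ k = h x := by
      simp only [h₁, Equiv.trans_apply]
      rw [swap_apply_of_ne_of_ne (by omega) hy''.symm, swap_apply_left]
    have hk' : h₁ (k + 1) = h y := by
      simp [h₁]
    have hconj : ∀ c, actCode h₁ (actCode (swap k (k + 1)) c) =
        actCode (swap (h x) (h y)) (actCode h₁ c) := by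
      intro c
      rw [actCode_actCode, actCode_actCode, ← hk, ← hk']
      congr 1
      funext i
      simp only [Function.comp_apply, h₁.injective.map_swap]
    refine ⟨h₁, ?_⟩
    have hex : ∃ c, actCode (swap k (k + 1)) c ≤ c ∧
        D (actCode h₁ (actCode (swap k (k + 1)) c)) ≠ D (actCode h₁ c) := by
      have hne : D (actCode h₁ (actCode (swap k (k + 1)) (actCode h₁.symm c))) ≠
          D (actCode h₁ (actCode h₁.symm c)) := by
        have hself : actCode h₁ (actCode h₁.symm c) = c := by
          rw [actCode_actCode, show h₁ ∘ h₁.symm = id from funext h₁.apply_symm_apply, actCode_id]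
        rwa [hconj, hself]
      rcases le_total (actCode (swap k (k + 1)) (actCode h₁.symm c)) (actCode h₁.symm c) with
        hle | hle
      · exact ⟨_, hle, hne⟩
      · refine ⟨actCode (swap k (k + 1)) (actCode h₁.symm c), ?_, ?_⟩
        · rwa [actCode_swap_swap]
        · rw [actCode_swap_swap]
          exact hne.symm
    classical
    refine ⟨Nat.find hex, fun i hi => ?_, Nat.find_spec hex, fun c hc => Nat.find_min' hex hc⟩
    simp only [h₁, Equiv.trans_apply]
    rw [swap_apply_of_ne_of_ne (a := k + 1) (by omega) (by omega),
      swap_apply_of_ne_of_ne (by omega) (by omega)]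
  -- exchange them if the coded bit is wrong
  obtain ⟨h₂, hh₂, ht₂, hb⟩ : ∃ h₂ : Perm ℕ, (∀ i < k, h₂ i = h i) ∧
      IsLeastSplit (fun c => D (actCode h₂ c)) k t ∧ D (actCode h₂ t) = b := by
    by_cases hb : D (actCode h₁ t) = b
    · exact ⟨h₁, hh₁, ht, hb⟩
    · have hact : ∀ c, actCode ((swap k (k + 1)).trans h₁) c =
          actCode h₁ (actCode (swap k (k + 1)) c) := fun c => by
        rw [actCode_actCode]; rfl
      refine ⟨(swap k (k + 1)).trans h₁, fun i hi => ?_, ?_, ?_⟩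
      · rw [Equiv.trans_apply, swap_apply_of_ne_of_ne (by omega) (by omega), hh₁ i hi]
      · simp only [hact]
        exact ht.actCode_swap
      · rw [hact]
        have := ht.1.2
        revert this hb
        dsimp only
        cases D (actCode h₁ t) <;> cases b <;> simp
  -- bring `v` to the position `t + 1`, which keeps the values up to `t`; by the `max`, nothing is
  -- moved if `v` is one of them
  have hkt := ht.lt
  refine ⟨(swap (t + 1) (max (t + 1) (h₂.symm v))).trans h₂, t, ?_⟩
  have hagree : ∀ i ≤ t, (swap (t + 1) (max (t + 1) (h₂.symm v))).trans h₂ i = h₂ i := by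
    intro i hi
    rw [Equiv.trans_apply, swap_apply_of_ne_of_ne (by omega) (by omega)]
  have hact : ∀ c ≤ t, D (actCode h₂ c) =
      D (actCode ((swap (t + 1) (max (t + 1) (h₂.symm v))).trans h₂) c) := fun c hc =>
    congrArg D (actCode_congr fun i hi => (hagree i (hi.le.trans hc)).symm)
  refine ⟨fun i hi => (hagree i (by omega)).trans (hh₂ i hi), ht₂.congr hact,
    (hact t le_rfl).symm.trans hb, ?_⟩
  rcases le_or_gt (h₂.symm v) t with hv | hv
  · exact ⟨h₂.symm v, by omega, (hagree _ hv).trans (h₂.apply_symm_apply v)⟩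
  · refine ⟨t + 1, by omega, ?_⟩
    rw [Equiv.trans_apply, swap_apply_left, max_eq_right hv, h₂.apply_symm_apply]

/-- Iterating the coding steps. As the `s`-th bit is chosen after the values of the permutation
below `s` are, it may depend on them; so the permutation can be coded into its own pullback. -/
theorem exists_coding
    (hD : ∀ F : Finset ℕ, ∃ x y c, x ∉ F ∧ y ∉ F ∧ D (actCode (swap x y) c) ≠ D c)
    (β : ℕ → (ℕ → ℕ) → Bool) (hβ : ∀ s g g', (∀ i < s, g i = g' i) → β s g = β s g') :
    ∃ (g : Perm ℕ) (k t : ℕ → ℕ), k 0 = 0 ∧ (∀ s, k (s + 1) = t s + 2) ∧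
      (∀ s, IsLeastSplit (fun c => D (actCode g c)) (k s) (t s)) ∧
      ∀ s, D (actCode g (t s)) = β s g := by
  choose H T hH hT hb hv using exists_coding_step hD
  let st : ℕ → Perm ℕ × ℕ := fun s => s.rec (Equiv.refl ℕ, 0) fun s p =>
    (H p.1 p.2 s (β s p.1), T p.1 p.2 s (β s p.1) + 2)
  let h : ℕ → Perm ℕ := fun s => (st s).1
  let k : ℕ → ℕ := fun s => (st s).2
  let t : ℕ → ℕ := fun s => T (h s) (k s) s (β s (h s))
  have hh : ∀ s, h (s + 1) = H (h s) (k s) s (β s (h s)) := fun _ => rfl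
  have hk : ∀ s, k (s + 1) = t s + 2 := fun _ => rfl
  have hlt : ∀ s, k s < t s := fun s => (hT _ _ _ _).lt
  have hmono : Monotone k := monotone_nat_of_le_succ fun s => by
    have := hlt s
    have := hk s
    omega
  have hle : ∀ s, s ≤ k s := by
    intro s
    induction s with
    | zero => exact Nat.zero_le _
    | succ s ih =>
      have := hlt s
      have := hk s
      omega
  have hstable : ∀ s s', s ≤ s' → ∀ i < k s, h s' i = h s i := by
    intro s s' hs
    induction s', hs using Nat.le_induction with
    | base => exact fun _ _ => rfl
    | succ s' hs ih =>
      intro i hi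
      rw [← ih i hi, hh]
      exact hH _ _ _ _ i (hi.trans_le (hmono hs))
  let g₀ : ℕ → ℕ := fun i => h (i + 1) i
  have hg₀ : ∀ s, ∀ i < k s, g₀ i = h s i := by
    intro s i hi
    rcases le_total (i + 1) s with hs | hs
    · exact (hstable _ _ hs i (hle (i + 1))).symm
    · exact hstable _ _ hs i hi
  have hbij : Function.Bijective g₀ := by
    refine ⟨fun i j hij => ?_, fun w => ?_⟩
    · have hi : i < k (i + j + 1) := lt_of_lt_of_le (by omega) (hle (i + j + 1))
      have hj : j < k (i + j + 1) := lt_of_lt_of_le (by omega) (hle (i + j + 1))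
      rw [hg₀ (i + j + 1) i hi, hg₀ (i + j + 1) j hj] at hij
      exact (h (i + j + 1)).injective hij
    · obtain ⟨j, hj, hjw⟩ := hv (h w) (k w) w (β w (h w))
      exact ⟨j, (hg₀ (w + 1) j hj).trans hjw⟩
  let g : Perm ℕ := Equiv.ofBijective g₀ hbij
  have hact : ∀ s, ∀ c ≤ t s, D (actCode (h (s + 1)) c) = D (actCode g c) := fun s c hc =>
    congrArg D (actCode_congr fun i hi => 
      (hg₀ (s + 1) i (by have := hk s; omega)).symm)
  refine ⟨g, k, t, rfl, hk, fun s => (hT _ _ _ _).congr (hact s), fun s => ?_⟩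
  rw [← hact s _ le_rfl, hh]
  exact (hb _ _ _ _).trans (hβ s _ _ fun i hi => (hg₀ s i (hi.trans_le (hle s))).symm)

end Coding

/-! ### Relative computability -/

section Computability

variable {O : Set (ℕ →. ℕ)}

theorem _root_.Computable.nat_recursiveIn {f : ℕ → ℕ} (hf : Computable f) :
    Nat.RecursiveIn O fun n => Part.some (f n) :=
  RecursiveIn.iff_nat.1 hf.computableIn

theorem _root_.Nat.RecursiveIn.comp_some {f : ℕ →. ℕ} {g : ℕ → ℕ} (hf : Nat.RecursiveIn O f)
    (hg : Nat.RecursiveIn O fun n => Part.some (g n)) : Nat.RecursiveIn O fun n => f (g n) :=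
  (hf.comp hg).of_eq fun n => Part.bind_some (g n) f

theorem _root_.Nat.RecursiveIn.pair_some {f g : ℕ → ℕ}
    (hf : Nat.RecursiveIn O fun n => Part.some (f n))
    (hg : Nat.RecursiveIn O fun n => Part.some (g n)) :
    Nat.RecursiveIn O fun n => Part.some (Nat.pair (f n) (g n)) :=
  (hf.pair hg).of_eq fun n => by simp [Seq.seq]

theorem Computes.trans {a b c : Cantor} (h : Computes a b) (h' : Computes b c) : Computes a c :=
  TuringReducible.trans h' h

theorem computes_comp {h : ℕ → ℕ} (hh : Computable h) (a : Cantor) :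
    Computes a fun n => a (h n) :=
  RecursiveIn.iff_nat.2 ((Nat.RecursiveIn.oracle (charFun a) (Set.mem_singleton _)).comp_some
    hh.nat_recursiveIn)

theorem join_two_mul (a b : Cantor) (n : ℕ) : join a b (2 * n) = a n := by
  simp [join]

theorem join_two_mul_add_one (a b : Cantor) (n : ℕ) : join a b (2 * n + 1) = b n := by
  rw [join, if_neg (by omega), show (2 * n + 1) / 2 = n by omega]

theorem computes_join_left (a b : Cantor) : Computes (join a b) a := by
  have h := computes_comp (h := fun n => 2 * n)
    (Primrec.nat_mul.comp (Primrec.const 2) Primrec.id).to_comp (join a b)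
  simpa only [join_two_mul] using h

theorem computes_join_right (a b : Cantor) : Computes (join a b) b := by
  have h := computes_comp (h := fun n => 2 * n + 1)
    (Primrec.succ.comp (Primrec.nat_mul.comp (Primrec.const 2) Primrec.id)).to_comp (join a b)
  simpa only [Nat.succ_eq_add_one, join_two_mul_add_one] using h

namespace OracleCode

/-- A program for the constant function with value `n`. -/
def const : ℕ → OracleCode
  | 0 => zero
  | n + 1 => comp succ (const n)

theorem eval_comp_of_eq_some {g : ℕ →. ℕ} {c d : OracleCode} {n m : ℕ}
    (h : d.eval g n = Part.some m) : (comp c d).eval g n = c.eval g m := by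
  change (d.eval g n).bind (c.eval g) = _
  rw [h]
  exact Part.bind_some _ _

theorem eval_const (g : ℕ →. ℕ) (n m : ℕ) : (const n).eval g m = Part.some n := by
  induction n with
  | zero => rfl
  | succ n ih => exact eval_comp_of_eq_some ih

/-- A program that ignores its input, and halts if and only if the value of the oracle at `n` is
positive. -/
def haltIf (n : ℕ) : OracleCode :=
  comp (rfind (comp (prec (const 1) zero) (pair zero left))) (comp oracle (const n))

theorem eval_haltIf_dom (a : Cantor) (n m : ℕ) :
    ((haltIf n).eval (charFun a) m).Dom ↔ a n = true := by
  have h : (haltIf n).eval (charFun a) m =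
      (rfind (comp (prec (const 1) zero) (pair zero left))).eval (charFun a) (a n).toNat :=
    (eval_comp_of_eq_some (eval_comp_of_eq_some (eval_const _ _ _))).trans rfl
  have h' : ∀ k, (comp (prec (const 1) zero) (pair zero left)).eval (charFun a)
      (Nat.pair (a n).toNat k) = Part.some (!a n).toNat := fun k => by
    rw [eval_comp_of_eq_some (m := Nat.pair 0 (a n).toNat) (by simp [eval, Seq.seq])]
    cases a n <;> simp [eval, eval_const]
  rw [h]
  refine Nat.rfind_dom.trans ⟨fun ⟨k, hk, _⟩ => ?_, fun hn => ⟨0, ?_, fun {i} hi => ?_⟩⟩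
  · rw [h'] at hk
    simpa using hk
  · rw [h']
    simpa using hn
  · exact absurd hi (Nat.not_lt_zero i)

theorem computable_index_haltIf : Computable fun n => (haltIf n).index := by
  have hconst : Primrec fun n => (const n).index := by
    refine (Primrec.nat_rec₁ (f := fun _ i => Nat.pair 6 (Nat.pair succ.index i)) zero.index
      (Primrec₂.natPair.comp (Primrec.const 6)
        (Primrec₂.natPair.comp (Primrec.const succ.index) Primrec.snd))).of_eq fun n => ?_
    induction n with
    | zero => rfl
    | succ n ih => simp only [const, index, ← ih]
  exact (Primrec₂.natPair.comp (Primrec.const 6) (Primrec₂.natPair.comp (Primrec.const _)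
    (Primrec₂.natPair.comp (Primrec.const 6) (Primrec₂.natPair.comp (Primrec.const _)
      hconst)))).to_comp

end OracleCode

theorem jump_eq_true {a : Cantor} {n : ℕ} : jump a n = true ↔
    ∃ c : OracleCode, c.index = n ∧ (c.eval (charFun a) n).Dom := by
  classical exact decide_eq_true_iff

theorem computes_jump (a : Cantor) : Computes (jump a) a := by
  convert computes_comp OracleCode.computable_index_haltIf (jump a) with n
  rw [Bool.eq_iff_iff, jump_eq_true]
  constructor
  · exact fun h => ⟨_, rfl, (OracleCode.eval_haltIf_dom _ _ _).2 h⟩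
  · rintro ⟨c, hc, h⟩
    rw [OracleCode.index_injective hc] at h
    exact (OracleCode.eval_haltIf_dom _ _ _).1 h

/-! ### Decoding -/

theorem primrec_actCode_swap :
    Primrec fun p : ℕ × ℕ => actCode (swap p.1 (p.1 + 1)) p.2 := by
  have hswap : Primrec₂ fun (p : ℕ × ℕ) (i : ℕ) => swap p.1 (p.1 + 1) i := by
    have hk : Primrec fun q : (ℕ × ℕ) × ℕ => q.1.1 := Primrec.fst.comp Primrec.fst
    have hk' : Primrec fun q : (ℕ × ℕ) × ℕ => q.1.1 + 1 := Primrec.succ.comp hk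
    exact (Primrec.ite (Primrec.eq.comp Primrec.snd hk) hk'
      (Primrec.ite (Primrec.eq.comp Primrec.snd hk') hk Primrec.snd)).of_eq fun q =>
        (swap_apply_def _ _ _).symm
  exact Primrec₂.natPair.comp (Primrec.fst.comp (Primrec.unpair.comp Primrec.snd))
    (Primrec.encode.comp (Primrec.list_map ((Primrec.ofNat _).comp
      (Primrec.snd.comp (Primrec.unpair.comp Primrec.snd))) hswap))

/-- The coded bits are computed from the coding set by searching for the least codes. -/
theorem computes_of_isLeastSplit {D : Cantor} {k t : ℕ → ℕ} (hk₀ : k 0 = 0)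
    (hk : ∀ s, k (s + 1) = t s + 2) (ht : ∀ s, IsLeastSplit D (k s) (t s)) :
    Computes D fun s => D (t s) := by
  let O : Set (ℕ →. ℕ) := {charFun D}
  have horacle : Nat.RecursiveIn O (charFun D) := .oracle _ rfl
  let σ : ℕ → ℕ := fun p => actCode (swap p.unpair.1 (p.unpair.1 + 1)) p.unpair.2
  have hσ : Primrec σ := primrec_actCode_swap.comp Primrec.unpair
  -- the test for being exchanged with a smaller code that has a different value
  let q : ℕ → ℕ := fun p => if σ p.unpair.1 ≤ p.unpair.1.unpair.2 ∧
    p.unpair.2.unpair.1 ≠ p.unpair.2.unpair.2 then 0 else 1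
  have hq : Computable q := by
    have h₁ : Primrec fun p : ℕ => p.unpair.1 := Primrec.fst.comp Primrec.unpair
    have h₂ : Primrec fun p : ℕ => p.unpair.2 := Primrec.snd.comp Primrec.unpair
    exact (Primrec.ite ((Primrec.nat_le.comp (hσ.comp h₁) (h₂.comp h₁)).and
      (Primrec.eq.comp (h₁.comp h₂) (h₂.comp h₂)).not) (Primrec.const 0)
      (Primrec.const 1)).to_comp
  have htest : Nat.RecursiveIn O fun p => Part.some (q (Nat.pair p
      (Nat.pair (D (σ p)).toNat (D p.unpair.2).toNat))) := by
    refine hq.nat_recursiveIn.comp_some (Computable.id.nat_recursiveIn.pair_some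
      (Nat.RecursiveIn.pair_some (f := fun p => (D (σ p)).toNat)
        (g := fun p => (D p.unpair.2).toNat) ?_ ?_))
    · exact horacle.comp_some hσ.to_comp.nat_recursiveIn
    · exact horacle.comp_some (Primrec.snd.comp Primrec.unpair).to_comp.nat_recursiveIn
  have htoNat : ∀ b b' : Bool, b.toNat = b'.toNat ↔ b = b' := by decide
  obtain ⟨T, hT, hTt⟩ : ∃ T : ℕ →. ℕ, Nat.RecursiveIn O T ∧ ∀ s, T (k s) = Part.some (t s) := by
    refine ⟨_, htest.rfind, fun s => Part.eq_some_iff.2 (Nat.mem_rfind.2 ⟨?_, fun {m} hm => ?_⟩)⟩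
    · have h := (ht s).1
      simpa [q, σ, htoNat] using h
    · have h : ¬ (actCode (swap (k s) (k s + 1)) m ≤ m ∧
          D (actCode (swap (k s) (k s + 1)) m) ≠ D m) := fun h => hm.not_ge ((ht s).2 h)
      simpa [q, σ, htoNat] using h
  have hstep : Nat.RecursiveIn O fun p => T p.unpair.2.unpair.2 >>= fun n => Part.some (n + 2) :=
    (Primrec.succ.comp Primrec.succ).to_comp.nat_recursiveIn.comp
      (hT.comp_some (Primrec.snd.comp (Primrec.unpair.comp
        (Primrec.snd.comp Primrec.unpair))).to_comp.nat_recursiveIn)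
  have hK : Nat.RecursiveIn O fun s => Part.some (k s) := by
    refine ((Nat.RecursiveIn.zero.prec hstep).comp_some (Primrec₂.natPair.comp (Primrec.const 0)
      Primrec.id).to_comp.nat_recursiveIn).of_eq fun s => ?_
    simp only [Nat.unpair_pair, id]
    induction s with
    | zero => exact congrArg Part.some hk₀.symm
    | succ s ih =>
      simp only [ih]
      simp [hTt, hk]
  have hT' : Nat.RecursiveIn O fun s => Part.some (t s) := (hT.comp_some hK).of_eq hTt
  exact RecursiveIn.iff_nat.2 (horacle.comp_some hT')

end Computability

section Copies

variable {L : FirstOrder.Language.{u, v}}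

/-- A non-trivial structure has an isomorphic copy that computes a given real and an isomorphism:
the coded bits are those of the given real and of the isomorphism itself. -/
theorem exists_codesIsom_computes {ν : L.Symbols → ℕ} (hν : Function.Injective ν)
    {M : ModSpace L} (hM : ¬ IsTrivial M) (r : Cantor) :
    ∃ (N : ModSpace L) (z : Cantor), CodesIsom M N z ∧ Computes (structureCode ν N) r ∧
      Computes (structureCode ν N) z := by
  obtain ⟨g, k, t, hk₀, hk, ht, hb⟩ := exists_coding (exists_actCode_swap_ne hν hM)
    (fun s g => join r (fun m => decide (g m.unpair.2 = m.unpair.1)) s) (by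
      intro s g g' h
      unfold join
      split_ifs
      · rfl
      · dsimp only
        rw [h (s / 2).unpair.2 ((Nat.unpair_right_le _).trans_lt (by omega))])
  have hiso := M.isIsoPerm_pullback g
  have hN : structureCode ν (M.pullback g) = fun c => structureCode ν M (actCode g c) :=
    funext fun c => (structureCode_actCode hiso c).symm
  have hcomp : Computes (structureCode ν (M.pullback g))
      (join r fun m => decide (g m.unpair.2 = m.unpair.1)) := by
    rw [hN]
    have h := computes_of_isLeastSplit hk₀ hk ht
    simpa only [hb] using h
  refine ⟨M.pullback g, _, ?_, hcomp.trans (computes_join_left _ _),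
    hcomp.trans (computes_join_right _ _)⟩
  obtain ⟨e, he⟩ := hiso.symm.exists_isom
  refine ⟨e, fun m n => ?_⟩
  dsimp only
  rw [he, Nat.unpair_pair, decide_eq_true_iff, Equiv.symm_apply_eq, eq_comm]

end Copies

/-! ### Borel measurability -/

section Measurability

theorem OracleCode.measurable_mem_eval (c : OracleCode) (n m : ℕ) :
    Measurable fun a : Cantor => m ∈ c.eval (charFun a) n := by
  induction c generalizing n m with
  | zero => exact measurable_const (a := m ∈ Part.some 0)
  | succ => exact measurable_const (a := m ∈ Part.some (n + 1))
  | left => exact measurable_const (a := m ∈ Part.some n.unpair.1)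
  | right => exact measurable_const (a := m ∈ Part.some n.unpair.2)
  | oracle =>
    exact (measurable_of_countable fun b : Bool => m ∈ Part.some b.toNat).comp
      (measurable_pi_apply n)
  | pair c d hc hd =>
    have h : (fun a : Cantor => m ∈ (c.pair d).eval (charFun a) n) = fun a =>
        ∃ i, i ∈ c.eval (charFun a) n ∧ ∃ j, j ∈ d.eval (charFun a) n ∧ Nat.pair i j = m := by
      funext a
      simp [OracleCode.eval, Seq.seq]
    rw [h]
    exact .exists fun i => (hc n i).and (.exists fun j => (hd n j).and measurable_const)
  | comp c d hc hd =>
    have h : (fun a : Cantor => m ∈ (c.comp d).eval (charFun a) n) = fun a =>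
        ∃ i, i ∈ d.eval (charFun a) n ∧ m ∈ c.eval (charFun a) i :=
      funext fun a => propext Part.mem_bind_iff
    rw [h]
    exact .exists fun i => (hd n i).and (hc i m)
  | prec c d hc hd =>
    obtain ⟨x, y, rfl⟩ : ∃ x y, n = Nat.pair x y := ⟨_, _, (Nat.pair_unpair n).symm⟩
    induction y generalizing m with
    | zero =>
      simpa [OracleCode.eval] using hc x m
    | succ y ih =>
      have h : (fun a : Cantor => m ∈ (c.prec d).eval (charFun a) (Nat.pair x (y + 1))) = fun a =>
          ∃ i, i ∈ (c.prec d).eval (charFun a) (Nat.pair x y) ∧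
            m ∈ d.eval (charFun a) (Nat.pair x (Nat.pair y i)) := by
        funext a
        simp only [OracleCode.eval, Nat.unpair_pair]
        exact propext Part.mem_bind_iff
      rw [h]
      exact .exists fun i => (ih i).and (hd _ m)
  | rfind c hc =>
    have h : (fun a : Cantor => m ∈ c.rfind.eval (charFun a) n) = fun a =>
        0 ∈ c.eval (charFun a) (Nat.pair n m) ∧
          ∀ k : Fin m, ∃ i, i ∈ c.eval (charFun a) (Nat.pair n k) ∧ i ≠ 0 := by
      funext a
      refine propext (Nat.mem_rfind.trans ?_)
      simp [Fin.forall_iff]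
    rw [h]
    exact (hc _ 0).and (.forall fun k => .exists fun i => (hc _ i).and measurable_const)

instance : Countable OracleCode := OracleCode.index_injective.countable

open Classical in
/-- The set of all `n` at which the program `c` with oracle `a` has the value `1`; if `c` computes
the characteristic function of a real, this is that real. -/
noncomputable def OracleCode.evalReal (c : OracleCode) (a : Cantor) : Cantor :=
  fun n => decide (1 ∈ c.eval (charFun a) n)

theorem Computes.exists_evalReal_eq {a b : Cantor} (h : Computes a b) :
    ∃ c : OracleCode, c.evalReal a = b := by
  obtain ⟨c, hc⟩ := (OracleCode.exists_eval_iff _ _).2 (RecursiveIn.iff_nat.1 h)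
  refine ⟨c, funext fun n => ?_⟩
  rw [OracleCode.evalReal, hc]
  cases hb : b n <;> simp [charFun, hb]

theorem measurable_decide {X : Type*} [MeasurableSpace X] {p : X → Prop} [DecidablePred p]
    (hp : Measurable p) : Measurable fun x => decide (p x) :=
  measurable_to_bool (by simpa [Set.preimage] using hp)

theorem OracleCode.measurable_evalReal (c : OracleCode) : Measurable c.evalReal := by
  classical
  exact measurable_pi_lambda _ fun n => measurable_decide (c.measurable_mem_eval n 1)

theorem measurable_jump : Measurable jump := by
  classical
  refine measurable_pi_lambda _ fun n => measurable_decide ?_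
  refine .exists fun c => .and measurable_const ?_
  simp only [Part.dom_iff_mem]
  exact .exists fun m => c.measurable_mem_eval n m

theorem measurable_join_left (b : Cantor) : Measurable fun a => join a b := by
  refine measurable_pi_lambda _ fun n => ?_
  unfold join
  split_ifs
  · exact measurable_pi_apply _
  · exact measurable_const

variable {L : FirstOrder.Language.{u, v}} {X : Type*} [MeasurableSpace X] {A B : X → ModSpace L}

theorem measurable_fn (hA : Measurable A) {n : ℕ} (f : L.Functions n) (x : Fin n → ℕ) :
    Measurable fun p => (A p).fn f x := by
  have h₀ : Continuous (ModSpace.equivProd L) := continuous_induced_dom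
  have h := continuous_pi_iff.1 (continuous_pi_iff.1 h₀.fst ⟨n, f⟩) x
  exact h.measurable.comp hA

theorem measurable_rel (hA : Measurable A) {n : ℕ} (R : L.Relations n) (x : Fin n → ℕ) :
    Measurable fun p => (A p).rel R x := by
  have h₀ : Continuous (ModSpace.equivProd L) := continuous_induced_dom
  have h := continuous_pi_iff.1 (continuous_pi_iff.1 h₀.snd ⟨n, R⟩) x
  have h' : Measurable fun M : ModSpace L => M.rel R x := by
    convert h.measurable.eq_const true using 2 with M
    classical exact decide_eq_true_iff.symm
  exact h'.comp hA

theorem countable_functions [Countable L.Symbols] (n : ℕ) : Countable (L.Functions n) :=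
  ((Sum.inl_injective (β := Σ n, L.Relations n)).comp
    (sigma_mk_injective (i := n))).countable (β := L.Symbols)

theorem countable_relations [Countable L.Symbols] (n : ℕ) : Countable (L.Relations n) :=
  ((Sum.inr_injective (α := Σ n, L.Functions n)).comp
    (sigma_mk_injective (i := n))).countable (β := L.Symbols)

theorem measurable_isIsoPerm [Countable L.Symbols] (hA : Measurable A) (hB : Measurable B)
    (g : Perm ℕ) : Measurable fun p => IsIsoPerm (A p) (B p) g := by
  have := countable_functions (L := L)
  have := countable_relations (L := L)
  refine .and (.forall fun n => .forall fun f => .forall fun x => ?_)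
    (.forall fun n => .forall fun R => .forall fun x => ?_)
  · exact measurableSet_setOfPred.1 (measurableSet_eq_fun
      ((measurable_of_countable g).comp (measurable_fn hA f x)) (measurable_fn hB f (g ∘ x)))
  · exact (measurable_rel hB R (g ∘ x)).iff (measurable_rel hA R x)

theorem measurable_eq [Countable L.Symbols] (hA : Measurable A) (hB : Measurable B) :
    Measurable fun p => A p = B p := by
  simpa only [isIsoPerm_refl_iff] using measurable_isIsoPerm hA hB (Equiv.refl ℕ)

theorem measurable_structureCode [Countable L.Symbols] (ν : L.Symbols → ℕ) :
    Measurable (structureCode ν) := by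
  have := countable_functions (L := L)
  have := countable_relations (L := L)
  classical
  refine measurable_pi_lambda _ fun c => measurable_decide ?_
  refine .or (.exists fun n => .exists fun f => .exists fun x => ?_)
    (.exists fun n => .exists fun R => .exists fun x => ?_)
  · exact (measurable_of_countable fun w =>
      c = Nat.pair (ν (Sum.inl ⟨n, f⟩)) (Encodable.encode (w :: List.ofFn x))).comp
        (measurable_fn measurable_id f x)
  · exact (measurable_rel measurable_id R x).and measurable_const

/-- Being the graph of an isomorphism, with quantifiers over numbers and symbols only. -/
theorem codesIsom_iff {M N : ModSpace L} {z : Cantor} : CodesIsom M N z ↔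
    ((∀ m, ∃ n, z (Nat.pair m n) = true) ∧
      (∀ m n n', z (Nat.pair m n) = true → z (Nat.pair m n') = true → n = n') ∧
      (∀ n, ∃ m, z (Nat.pair m n) = true) ∧
      (∀ m m' n, z (Nat.pair m n) = true → z (Nat.pair m' n) = true → m = m')) ∧
    (∀ (n : ℕ) (f : L.Functions n) (x y : Fin n → ℕ) (w : ℕ),
      (∀ i, z (Nat.pair (x i) (y i)) = true) → M.fn f x = w →
        z (Nat.pair w (N.fn f y)) = true) ∧
    ∀ (n : ℕ) (R : L.Relations n) (x y : Fin n → ℕ),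
      (∀ i, z (Nat.pair (x i) (y i)) = true) → (N.rel R y ↔ M.rel R x) := by
  constructor
  · rintro ⟨e, he⟩
    have hiso := e.isIsoPerm
    simp only [he]
    refine ⟨⟨fun m => ⟨_, rfl⟩, fun m n n' h h' => h.symm.trans h', fun n =>
      ⟨e.toPerm.symm n, e.toPerm.apply_symm_apply n⟩, fun m m' n h h' =>
      e.toPerm.injective (h.trans h'.symm)⟩, ?_, ?_⟩
    · rintro n f x y _ hxy rfl
      obtain rfl : e.toPerm ∘ x = y := funext hxy
      exact hiso.1 n f x
    · intro n R x y hxy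
      obtain rfl : e.toPerm ∘ x = y := funext hxy
      exact hiso.2 n R x
  · rintro ⟨⟨htot, hfun, hsurj, hinj⟩, hf, hR⟩
    choose g₀ hg₀ using htot
    have hz : ∀ m n, z (Nat.pair m n) = true ↔ g₀ m = n := fun m n =>
      ⟨hfun m _ _ (hg₀ m), fun h => h ▸ hg₀ m⟩
    let g : Perm ℕ := Equiv.ofBijective g₀
      ⟨fun m m' h => hinj m m' (g₀ m) (hg₀ m) (h ▸ hg₀ m'), fun n => by
        obtain ⟨m, hm⟩ := hsurj n
        exact ⟨m, (hz m n).1 hm⟩⟩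
    obtain ⟨e, he⟩ : ∃ e : Isom M N, Isom.toPerm e = g :=
      IsIsoPerm.exists_isom ⟨fun n f x => (hz _ _).1 (hf n f x (g ∘ x) _ (fun i => hg₀ (x i)) rfl),
        fun n R x => hR n R x (g ∘ x) fun i => hg₀ (x i)⟩
    exact ⟨e, fun m n => by rw [hz, he]; rfl⟩

theorem measurable_codesIsom [Countable L.Symbols] (hA : Measurable A) (hB : Measurable B)
    {Z : X → Cantor} (hZ : Measurable Z) : Measurable fun p => CodesIsom (A p) (B p) (Z p) := by
  have := countable_functions (L := L)
  have := countable_relations (L := L)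
  have hz : ∀ k, Measurable fun p => Z p k = true := fun k =>
    ((measurable_pi_apply k).comp hZ).eq_const true
  simp only [codesIsom_iff]
  refine .and (.and ?_ (.and ?_ (.and ?_ ?_))) (.and ?_ ?_)
  · exact .forall fun m => .exists fun n => hz _
  · exact .forall fun m => .forall fun n => .forall fun n' =>
      (hz _).imp ((hz _).imp measurable_const)
  · exact .forall fun n => .exists fun m => hz _
  · exact .forall fun m => .forall fun m' => .forall fun n =>
      (hz _).imp ((hz _).imp measurable_const)
  · refine .forall fun n => .forall fun f => .forall fun x => .forall fun y => .forall fun w =>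
      .imp (.forall fun i => hz _) (.imp ((measurable_fn hA f x).eq_const w) ?_)
    have h : (fun p => Z p (Nat.pair w ((B p).fn f y)) = true) =
        fun p => ∃ w', (B p).fn f y = w' ∧ Z p (Nat.pair w w') = true := by
      funext p
      simp
    rw [h]
    exact .exists fun w' => ((measurable_fn hB f y).eq_const w').and (hz _)
  · exact .forall fun n => .forall fun R => .forall fun x => .forall fun y =>
      .imp (.forall fun i => hz _) ((measurable_rel hB R y).iff (measurable_rel hA R x))

theorem measurableSet_trivialStructures [Countable L.Symbols] :
    MeasurableSet (trivialStructures L) := by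
  simp only [trivialStructures, isTrivial_iff_exists_swap, measurableSet_setOfPred]
  exact .exists fun F => .forall fun x => .forall fun y => .imp measurable_const
    (.imp measurable_const (measurable_isIsoPerm measurable_id measurable_id _))

end Measurability

/-! ### Isomorphism of trivial structures is Borel -/

section Trivial

variable {L : FirstOrder.Language.{u, v}} {M N : ModSpace L}

/-- The finitely supported permutations of `ℕ`, given by their tables. -/
abbrev TablePerm : Type := {k : Perm ℕ // ∃ l, ∀ n, k n = tableFun l n}

instance : Countable TablePerm := by
  have h : Function.Injective fun k : TablePerm => k.2.choose := fun k k' hkk' => by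
    refine Subtype.ext (Equiv.ext fun n => ?_)
    rw [k.2.choose_spec n, k'.2.choose_spec n]
    exact congrArg (tableFun · n) hkk'
  exact h.countable

theorem IsTrivial.nonempty_isom_iff (hM : IsTrivial M) :
    Nonempty (Isom M N) ↔ ∃ k : TablePerm, IsIsoPerm M N k := by
  rw [BorelGraphing.nonempty_isom_iff]
  constructor
  · rintro ⟨g, hg⟩
    obtain ⟨l, k, hk, hl⟩ := hM.exists_tableFun hg
    exact ⟨⟨k, l, hl⟩, hk⟩
  · rintro ⟨k, hk⟩
    exact ⟨k, hk⟩

theorem IsTrivial.exists_computable (hM : IsTrivial M) (h : Nonempty (Isom M N)) :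
    ∃ e : Isom M N, Computable fun n => Isom.toPerm e n := by
  obtain ⟨⟨k, l, hl⟩, hk⟩ := hM.nonempty_isom_iff.1 h
  obtain ⟨e, rfl⟩ := hk.exists_isom
  exact ⟨e, (computable_tableFun l).of_eq fun n => (hl n).symm⟩

theorem measurableSet_isoSetoidOn_trivialStructures [Countable L.Symbols] :
    MeasurableSet {p : trivialStructures L × trivialStructures L |
      isoSetoidOn (trivialStructures L) p.1 p.2} := by
  have h : {p : trivialStructures L × trivialStructures L |
      isoSetoidOn (trivialStructures L) p.1 p.2} =
      {p | ∃ k : TablePerm, IsIsoPerm p.1.1 p.2.1 k} :=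
    Set.ext fun p => IsTrivial.nonempty_isom_iff p.1.2
  rw [h, measurableSet_setOfPred]
  exact .exists fun k => measurable_isIsoPerm (measurable_subtype_coe.comp measurable_fst)
    (measurable_subtype_coe.comp measurable_snd) k.1

end Trivial

/-! ### Witness coding for non-trivial structures -/

section WitnessCoding

variable {L : FirstOrder.Language.{u, v}} {M N : ModSpace L}

theorem CodesIsom.nonempty {z : Cantor} (h : CodesIsom M N z) : Nonempty (Isom M N) :=
  ⟨h.choose⟩

theorem exists_codesIsom (h : Nonempty (Isom M N)) : ∃ z, CodesIsom M N z := by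
  obtain ⟨e⟩ := h
  exact ⟨fun k => decide (e.toPerm k.unpair.1 = k.unpair.2), e, fun m n => by simp⟩

theorem isUnfolding_isoUnfolding [Countable L.Symbols] (S : Set (ModSpace L)) :
    IsUnfolding (isoSetoidOn S) (isoUnfolding S) where
  measurableSet := by
    have h₁ : Measurable fun p : S × S × Cantor => (p.1 : ModSpace L) :=
      measurable_subtype_coe.comp measurable_fst
    have h₂ : Measurable fun p : S × S × Cantor => (p.2.1 : ModSpace L) :=
      measurable_subtype_coe.comp (measurable_fst.comp measurable_snd)
    have h₃ : Measurable fun p : S × S × Cantor => p.2.2 := measurable_snd.comp measurable_snd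
    simp only [isoUnfolding, Subtype.ext_iff, measurableSet_setOfPred]
    exact (measurable_eq h₁ h₂).or
      ((measurable_codesIsom h₁ h₂ h₃).or (measurable_codesIsom h₂ h₁ h₃))
  refl_mem _ _ := .inl rfl
  symm_mem _ _ _ := or_congr eq_comm or_comm
  rel_iff x y := by
    constructor
    · intro h
      obtain ⟨z, hz⟩ := exists_codesIsom h
      exact ⟨z, .inr (.inl hz)⟩
    · rintro ⟨z, h | h | h⟩
      · obtain rfl : x = y := h
        exact (isoSetoidOn S).refl x
      · exact h.nonempty
      · exact (isoSetoidOn S).symm h.nonempty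

theorem exists_codesIsom_computes_jump {ν : L.Symbols → ℕ} (hν : Function.Injective ν)
    (hM : ¬ IsTrivial M) (r : Cantor) :
    ∃ (N : ModSpace L) (z : Cantor), CodesIsom M N z ∧
      Computes (jump (join (structureCode ν N) (languageCode ν))) r ∧
      Computes (jump (join (structureCode ν N) (languageCode ν))) z := by
  obtain ⟨N, z, h, hr, hz⟩ := exists_codesIsom_computes hν hM r
  have hN := (computes_jump _).trans
    (computes_join_left (structureCode ν N) (languageCode ν))
  exact ⟨N, z, h, hN.trans hr, hN.trans hz⟩

theorem isTrivial_iff_of_isom (h : Nonempty (Isom M N)) : IsTrivial M ↔ IsTrivial N := by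
  obtain ⟨g, hg⟩ := nonempty_isom_iff.1 h
  exact ⟨fun hM => hM.of_isIsoPerm hg, fun hN => hN.of_isIsoPerm hg.symm⟩

theorem isWitnessCoding_jump [Countable L.Symbols] {ν : L.Symbols → ℕ}
    (hν : Function.Injective ν) :
    IsWitnessCoding (isoSetoidOn (nontrivialStructures L))
      (isoUnfolding (nontrivialStructures L))
      (fun M => jump (join (structureCode ν M.1) (languageCode ν))) where
  isUnfolding := isUnfolding_isoUnfolding _
  measurable := measurable_jump.comp ((measurable_join_left _).comp
    ((measurable_structureCode ν).comp measurable_subtype_coe))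
  coding := by
    rintro ⟨M, hM⟩ a
    obtain ⟨N, z, h, ha, hz⟩ := exists_codesIsom_computes_jump hν hM a
    exact ⟨⟨N, fun hN => hM ((isTrivial_iff_of_isom h.nonempty).2 hN)⟩, h.nonempty, ha, z,
      .inr (.inl h), hz⟩

end WitnessCoding

/-! ### The Borel graphing -/

section Graphing

theorem isBorelGraphableWithDiam_two {X : Type*} [MeasurableSpace X] {E : Setoid X}
    {R : X → X → Prop} (heq : Measurable fun p : X × X => p.1 = p.2)
    (hR : Measurable fun p : X × X => R p.1 p.2) (hRE : ∀ x y, R x y → E x y)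
    (hER : ∀ x y, E x y → R x y ∨ ∃ w, R x w ∧ R y w) : IsBorelGraphableWithDiam E 2 := by
  let G := SimpleGraph.fromRel R
  have hedge : ∀ x y, R x y → ∃ p : G.Walk x y, p.length ≤ 1 := by
    intro x y h
    rcases eq_or_ne x y with rfl | hne
    · exact ⟨.nil, Nat.zero_le _⟩
    · exact ⟨SimpleGraph.Adj.toWalk (show G.Adj x y from ⟨hne, .inl h⟩), le_rfl⟩
  have hwalk : ∀ x y, E x y → ∃ p : G.Walk x y, p.length ≤ 2 := by
    intro x y h
    rcases hER x y h with h | ⟨w, hx, hy⟩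
    · obtain ⟨p, hp⟩ := hedge x y h
      exact ⟨p, by omega⟩
    · obtain ⟨p, hp⟩ := hedge x w hx
      obtain ⟨q, hq⟩ := hedge y w hy
      refine ⟨p.append q.reverse, ?_⟩
      rw [SimpleGraph.Walk.length_append, SimpleGraph.Walk.length_reverse]
      omega
  have hreach : ∀ x y, G.Reachable x y → E x y := by
    rintro x y ⟨p⟩
    induction p with
    | nil => exact E.refl _
    | cons h _ ih =>
      exact E.trans (h.2.elim (hRE _ _) fun h => E.symm (hRE _ _ h)) ih
  refine ⟨G, ⟨?_, fun x y => ⟨fun h => ⟨(hwalk x y h).choose⟩, hreach x y⟩⟩, fun x y h => ?_⟩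
  · exact (heq.not.and (hR.or (hR.comp measurable_swap))).setOf
  · obtain ⟨p, hp⟩ := hwalk x y (hreach x y h)
    exact (SimpleGraph.dist_le p).trans hp

/-- If `u` and `v` are the graphs of bijections from the same set, this is the graph of the
bijection from the range of `u` to the range of `v` that they induce. -/
noncomputable def graphQuotient (u v : Cantor) : Cantor := open Classical in fun k =>
  decide (∃ m, u (Nat.pair m k.unpair.1) = true ∧ v (Nat.pair m k.unpair.2) = true)

theorem measurable_graphQuotient {X : Type*} [MeasurableSpace X] {U V : X → Cantor}
    (hU : Measurable U) (hV : Measurable V) : Measurable fun p => graphQuotient (U p) (V p) := by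
  classical
  exact measurable_pi_lambda _ fun k => measurable_decide (.exists fun m =>
    (((measurable_pi_apply _).comp hU).eq_const true).and
      (((measurable_pi_apply _).comp hV).eq_const true))

variable {L : FirstOrder.Language.{u, v}}

theorem CodesIsom.graphQuotient {M N P : ModSpace L} {u v : Cantor} (hu : CodesIsom M N u)
    (hv : CodesIsom M P v) : CodesIsom N P (graphQuotient u v) := by
  obtain ⟨d, hd⟩ := hu
  obtain ⟨e, he⟩ := hv
  obtain ⟨k, hk⟩ := (d.isIsoPerm.symm.trans e.isIsoPerm).exists_isom
  refine ⟨k, fun m n => ?_⟩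
  rw [hk]
  simp only [BorelGraphing.graphQuotient, Nat.unpair_pair, hd, he, decide_eq_true_eq,
    Equiv.trans_apply]
  exact ⟨fun ⟨i, hi, hi'⟩ => by rw [← hi, Equiv.symm_apply_apply, hi'],
    fun h => ⟨_, Equiv.apply_symm_apply _ _, h⟩⟩

/-- A trivial structure is joined to all isomorphic ones. Moreover, `M` is joined to `N` if `N`
computes an isomorphism from `M` to `N`, or the graphs of two bijections that induce one. If `M` is
non-trivial and isomorphic to `N`, then both are joined to a copy of `M` that computes isomorphisms
from `M` to `N` and to itself. -/
theorem isBorelGraphableWithDiam_isoSetoid [Countable L.Symbols] :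
    IsBorelGraphableWithDiam (isoSetoid L) 2 := by
  obtain ⟨ν, hν⟩ := exists_injective_nat L.Symbols
  let f : OracleCode → ModSpace L → Cantor := fun c M => c.evalReal (structureCode ν M)
  have hf : ∀ c, Measurable fun p : ModSpace L × ModSpace L => f c p.2 := fun c =>
    c.measurable_evalReal.comp ((measurable_structureCode ν).comp measurable_snd)
  let R : ModSpace L → ModSpace L → Prop := fun M N =>
    (IsTrivial M ∧ ∃ k : TablePerm, IsIsoPerm M N k) ∨
      (∃ c, CodesIsom M N (f c N)) ∨ ∃ c d, CodesIsom M N (graphQuotient (f c N) (f d N))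
  refine isBorelGraphableWithDiam_two (R := R) (measurable_eq measurable_fst measurable_snd)
    ?_ ?_ ?_
  · refine .or (.and ?_ (.exists fun k => measurable_isIsoPerm measurable_fst measurable_snd k.1))
      (.or (.exists fun c => measurable_codesIsom measurable_fst measurable_snd (hf c))
        (.exists fun c => .exists fun d => measurable_codesIsom measurable_fst measurable_snd
          (measurable_graphQuotient (hf c) (hf d))))
    exact (measurableSet_setOfPred.1 measurableSet_trivialStructures).comp measurable_fst
  · rintro M N (⟨hM, h⟩ | ⟨c, h⟩ | ⟨c, d, h⟩)
    · exact hM.nonempty_isom_iff.2 h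
    · exact h.nonempty
    · exact h.nonempty
  · intro M N h
    by_cases hM : IsTrivial M
    · exact .inl (.inl ⟨hM, hM.nonempty_isom_iff.1 h⟩)
    · obtain ⟨r, hr⟩ := exists_codesIsom h
      obtain ⟨P, z, hz, hPr, hPz⟩ := exists_codesIsom_computes hν hM r
      obtain ⟨c, rfl⟩ := hPr.exists_evalReal_eq
      obtain ⟨d, rfl⟩ := hPz.exists_evalReal_eq
      exact .inr ⟨P, .inr (.inl ⟨d, hz⟩), .inr (.inr ⟨c, d, hr.graphQuotient hz⟩)⟩

end Graphing

end BorelGraphing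

theorem mainTheorem4 (L : FirstOrder.Language.{u, v}) [Countable L.Symbols] :
    -- isomorphism on `Mod(L)` is Borel graphable with diameter 2
    BorelGraphing.IsBorelGraphableWithDiam (BorelGraphing.isoSetoid L) 2 ∧
    -- the trivial structures form an isomorphism invariant Borel set
    (MeasurableSet (BorelGraphing.trivialStructures L) ∧
      ∀ M N : BorelGraphing.ModSpace L, Nonempty (BorelGraphing.Isom M N) →
        (BorelGraphing.IsTrivial M ↔ BorelGraphing.IsTrivial N)) ∧
    -- isomorphic trivial structures are computably isomorphic, and isomorphism of trivial
    -- structures is Borel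
    ((∀ M N : BorelGraphing.ModSpace L, BorelGraphing.IsTrivial M → BorelGraphing.IsTrivial N →
        Nonempty (BorelGraphing.Isom M N) →
          ∃ e : BorelGraphing.Isom M N, Computable (fun n => BorelGraphing.Isom.toPerm e n)) ∧
      MeasurableSet {p : BorelGraphing.trivialStructures L × BorelGraphing.trivialStructures L |
        BorelGraphing.isoSetoidOn (BorelGraphing.trivialStructures L) p.1 p.2}) ∧
    -- isomorphism of non-trivial structures has the Borel witness coding property
    (BorelGraphing.HasBorelWitnessCodingProperty
        (BorelGraphing.isoSetoidOn (BorelGraphing.nontrivialStructures L)) ∧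
      -- and this is verified by the map sending `M` to the Turing jump of `M ⊕ L`
      ∀ ν : L.Symbols → ℕ, Function.Injective ν →
        BorelGraphing.IsWitnessCoding
          (BorelGraphing.isoSetoidOn (BorelGraphing.nontrivialStructures L))
          (BorelGraphing.isoUnfolding (BorelGraphing.nontrivialStructures L))
          (fun M => BorelGraphing.jump (BorelGraphing.join
            (BorelGraphing.structureCode ν M.1) (BorelGraphing.languageCode ν))) ∧
        -- in fact, this jump computes a given real and an isomorphism
        ∀ (M : BorelGraphing.ModSpace L) (r : BorelGraphing.Cantor),
          ¬ BorelGraphing.IsTrivial M →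
            ∃ (N : BorelGraphing.ModSpace L) (z : BorelGraphing.Cantor),
              BorelGraphing.CodesIsom M N z ∧
              BorelGraphing.Computes (BorelGraphing.jump (BorelGraphing.join
                (BorelGraphing.structureCode ν N) (BorelGraphing.languageCode ν))) r ∧
              BorelGraphing.Computes (BorelGraphing.jump (BorelGraphing.join
                (BorelGraphing.structureCode ν N) (BorelGraphing.languageCode ν))) z) := by
  obtain ⟨ν₀, hν₀⟩ := exists_injective_nat L.Symbols
  exact ⟨BorelGraphing.isBorelGraphableWithDiam_isoSetoid,
    ⟨BorelGraphing.measurableSet_trivialStructures, fun _ _ => BorelGraphing.isTrivial_iff_of_isom⟩,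
    ⟨fun _ _ hM _ => hM.exists_computable,
      BorelGraphing.measurableSet_isoSetoidOn_trivialStructures⟩,
    ⟨_, _, BorelGraphing.isWitnessCoding_jump hν₀⟩,
    fun _ hν => ⟨BorelGraphing.isWitnessCoding_jump hν,
      fun _ r hM => BorelGraphing.exists_codesIsom_computes_jump hν hM r⟩⟩
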